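/- Let $(\Omega,\mathcal F,P)$ be a probability space and let $D\subseteq\mathbb R$ be a non-empty Borel set such that $D\cap(t-r,t+r)$ has positive Lebesgue measure for every $t\in D$ and $r>0$ (for example a non-degenerate interval). Let $X:D\times\Omega\to\mathbb R$, $X_t=X(t,\cdot)$, be a stochastic process (each $X_t$ is measurable) that is centered ($\mathbb E[X_t]=0$ for all $t\in D$) and mean-square continuous ($\mathbb E[(X_s-X_t)^2]\to0$ as $s\to t$ in $D$, for all $t\in D$), with $X\in L^2(D\times\Omega)$. Put $R_X(s,t)=\mathbb E[X_sX_t]$ and $[Ku](s)=\int_D R_X(s,t)u(t)\,dt$. Then there exist an orthonormal basis $\{e_i\}_{i\ge1}$ of $L^2(D)$, consisting of functions $e_i:D\to\mathbb R$ defined at every point of $D$, and numbers $\lambda_i\ge0$ such that $[Ke_i](s)=\lambda_ie_i(s)$ for all $s\in D$ and all $i$, and such that the following holds. For every $i$ the integral $x_i(\omega)=\int_D X_t(\omega)e_i(t)\,dt$ exists for almost every $\omega$, and if $\lambda_i=0$ then $x_i=0$ almost surely. The variables $$\xi_i(\omega)=\frac1{\sqrt{\lambda_i}}\int_D X_t(\omega)e_i(t)\,dt\qquad(\lambda_i>0)$$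 are square-integrable (defined up to null sets), centered, of unit variance and mutually uncorrelated. For every $t\in D$, $X_t\in L^2(\Omega)$ and $$X(t,\omega)=\sum_{i=1}^\infty\sqrt{\lambda_i}\,\xi_i(\omega)\,e_i(t)\qquad\text{in }L^2(\Omega),$$ that is, the partial sums converge to $X_t$ in $L^2(\Omega)$, where terms with $\lambda_i=0$ are understood to be $0$. -/

import Mathlib

open MeasureTheory ProbabilityTheory Filter Topology

attribute [local instance] MeasureTheory.Measure.Subtype.measureSpace

noncomputable section

/-- A (real) stochastic process indexed by `D`: each `X t` is a random variable. -/
def IsStochasticProcess {D : Set ℝ} {Ω : Type*} [MeasurableSpace Ω] (X : D → Ω → ℝ) : Prop :=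
  ∀ t : D, Measurable (X t)

/-- The process is centered: `E[X_t] = 0` for all `t ∈ D`. -/
def IsCentered {D : Set ℝ} {Ω : Type*} [MeasurableSpace Ω] (X : D → Ω → ℝ) (P : Measure Ω) :
    Prop :=
  ∀ t : D, ∫ ω, X t ω ∂P = 0

/-- Mean-square continuity: `E[(X_s - X_t)²] → 0` as `s → t` in `D`. The expectation of the
nonnegative variable is taken in `[0, ∞]`. -/
def IsMeanSquareContinuous {D : Set ℝ} {Ω : Type*} [MeasurableSpace Ω] (X : D → Ω → ℝ)
    (P : Measure Ω) : Prop :=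
  ∀ t : D, Tendsto (fun s : D => ∫⁻ ω, ENNReal.ofReal ((X s ω - X t ω) ^ 2) ∂P) (𝓝 t) (𝓝 0)

/-- The autocorrelation function `R_X(s,t) = E[X_s X_t]`. -/
def autocorrelation {D : Set ℝ} {Ω : Type*} [MeasurableSpace Ω] (X : D → Ω → ℝ)
    (P : Measure Ω) (s t : D) : ℝ :=
  ∫ ω, X s ω * X t ω ∂P

/-- The integral operator `(K u)(s) = ∫_D R_X(s,t) u(t) dt`, where `dt` is Lebesgue measure
on `D`. -/
def autocorrelationOperator {D : Set ℝ} {Ω : Type*} [MeasurableSpace Ω] (X : D → Ω → ℝ)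
    (P : Measure Ω) (u : D → ℝ) (s : D) : ℝ :=
  ∫ t : D, autocorrelation X P s t * u t

end

/-! Read the process as a random element `Y` of L²(D), and let `C` send `u` to ⟪Y, u⟫ in L²(Ω). The
adjoint of `C` sends `Z` to E[Z Y], a vector represented by t ↦ E[X_t Z], so C*C = E[Y ⊗ Y] is the
autocorrelation operator. It is symmetric and positive, and compact as a mean of rank-one operators
(`isCompactOperator_secondMomentOperator`). Since L²(D) is infinite-dimensional,
`exists_hilbertBasis_nat_eigenvectors` gives an eigenbasis b_i, and ⟪C b_i, C b_j⟫ = λ_i δ_ij makes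
the coefficients uncorrelated.

Convergence at every t needs no Mercer theorem. If Z is orthogonal to every C b_i, then E[Z Y] = 0,
so E[X_t Z] = 0 for almost every t, and then for every t, because t ↦ X_t is continuous into L²(Ω)
and Lebesgue measure charges every nonempty open subset of D. Hence X_t lies in the closed span of
the C b_i and is the sum of its orthonormal expansion (`Orthonormal.hasSum_inner_smul`). -/

open scoped InnerProductSpace

/-! ### Orthonormal expansions, compact symmetric operators, second-moment operators. -/

section Hilbert

variable {H : Type*} [NormedAddCommGroup H] [InnerProductSpace ℝ H]

/-- An orthonormal family in a separable space is countable. -/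
theorem Orthonormal.countable_of_separableSpace [TopologicalSpace.SeparableSpace H]
    {ι : Type*} {v : ι → H} (hv : Orthonormal ℝ v) : Countable ι := by
  refine Pairwise.countable_of_isOpen_disjoint (s := fun i => Metric.ball (v i) (1 / 2)) ?_
    (fun i => Metric.isOpen_ball) (fun i => Metric.nonempty_ball.2 (by norm_num))
  intro i j hij
  -- Distinct members are √2 apart, which exceeds 1/2 + 1/2.
  refine Metric.ball_disjoint_ball ?_
  have h : ‖v i - v j‖ ^ 2 = 2 := by
    rw [@norm_sub_sq_real, hv.1, hv.1, hv.2 hij]; norm_num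
  rw [dist_eq_norm]
  nlinarith [norm_nonneg (v i - v j)]

/-- A vector is the sum of its orthonormal expansion as soon as it is orthogonal to every vector
orthogonal to the orthonormal family. -/
theorem Orthonormal.hasSum_inner_smul [CompleteSpace H] {ι : Type*} {v : ι → H}
    (hv : Orthonormal ℝ v) {x : H} (hx : ∀ z, (∀ i, ⟪v i, z⟫_ℝ = 0) → ⟪x, z⟫_ℝ = 0) :
    HasSum (fun i => ⟪v i, x⟫_ℝ • v i) x := by
  have hs : Summable (fun i => ⟪v i, x⟫_ℝ • v i) := by
    have := (hv.orthogonalFamily.summable_iff_norm_sq_summable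
      (fun i => ⟪v i, x⟫_ℝ)).2 (hv.inner_products_summable (x := x))
    simpa using this
  obtain ⟨y, hy⟩ := hs
  have hinner : ∀ j, ⟪v j, x - y⟫_ℝ = 0 := by
    intro j
    have h1 := (innerSL ℝ (v j)).hasSum hy
    have h2 : HasSum (fun i => innerSL ℝ (v j) (⟪v i, x⟫_ℝ • v i)) ⟪v j, x⟫_ℝ := by
      convert hasSum_single j ?_ using 1
      · simp [hv.1]
      · intro i hi
        simp [hv.2 hi.symm]
    rw [inner_sub_right, sub_eq_zero]
    exact h2.unique h1
  have hy0 : ⟪x - y, y⟫_ℝ = 0 := by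
    have h1 := (innerSL ℝ (x - y)).hasSum hy
    refine h1.unique ?_
    convert hasSum_zero using 2 with i
    simp only [innerSL_apply_apply, inner_smul_right, real_inner_comm, hinner, mul_zero]
  -- The residual is orthogonal to `y` by `hy0`, and to `x` by `hx`, hence to itself.
  have h0 : ⟪x - y, x - y⟫_ℝ = 0 := by
    rw [inner_sub_right, hy0, real_inner_comm, hx _ hinner, sub_zero]
  rw [inner_self_eq_zero, sub_eq_zero] at h0
  rwa [← h0] at hy

/-- A compact symmetric operator on an infinite-dimensional separable real Hilbert space has a
Hilbert basis of eigenvectors indexed by `ℕ`. -/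
theorem exists_hilbertBasis_nat_eigenvectors [CompleteSpace H] [TopologicalSpace.SeparableSpace H]
    (hH : ¬ FiniteDimensional ℝ H) {T : H →L[ℝ] H} (hT : IsCompactOperator T)
    (hT' : T.IsSymmetric) :
    ∃ (b : HilbertBasis ℕ ℝ H) (lam : ℕ → ℝ), ∀ i, T (b i) = lam i • b i := by
  classical
  let V : ℝ → Submodule ℝ H := fun μ => Module.End.eigenspace (T : Module.End ℝ H) μ
  have hVc : ∀ μ, IsClosed (V μ : Set H) := by
    intro μ
    have : (V μ : Set H) = {x | T x = μ • x} := by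
      ext x; simp [V]
    rw [this]
    exact isClosed_eq T.continuous (continuous_const_smul μ)
  have hVcomp : ∀ μ, CompleteSpace (V μ) := fun μ => (hVc μ).completeSpace_coe
  -- Every real `μ` is allowed: a non-eigenvalue contributes an empty basis, and `μ = 0` contributes
  -- the kernel.
  choose w c hc using fun μ => exists_hilbertBasis ℝ (V μ)
  let v : (Σ μ, w μ) → H := fun a => (c a.1 a.2 : V a.1)
  have hv : Orthonormal ℝ v :=
    hT'.orthogonalFamily_eigenspaces.orthonormal_sigma_orthonormal
      (v_family := fun μ => c μ) (fun μ => (c μ).orthonormal)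
  have hbot : (Submodule.span ℝ (Set.range v))ᗮ = ⊥ := by
    rw [← ContinuousLinearMap.orthogonalComplement_iSup_eigenspaces_eq_bot hT hT', eq_comm]
    refine le_antisymm (Submodule.orthogonal_le ?_) ?_
    · rw [Submodule.span_le]
      rintro _ ⟨a, rfl⟩
      exact Submodule.mem_iSup_of_mem a.1 (c a.1 a.2).2
    · intro x hx
      rw [← Submodule.iInf_orthogonal, Submodule.mem_iInf]
      intro μ y hy
      have h1 := (V μ).subtypeL.hasSum ((c μ).hasSum_repr ⟨y, hy⟩)
      have h2 := (innerSL ℝ x).hasSum h1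
      rw [real_inner_comm]
      refine h2.unique ?_
      convert hasSum_zero using 2 with i
      have h3 : ⟪v ⟨μ, i⟩, x⟫_ℝ = 0 := hx _ (Submodule.subset_span ⟨⟨μ, i⟩, rfl⟩)
      have h4 : ⟪x, ((c μ i : V μ) : H)⟫_ℝ = 0 := by rw [real_inner_comm]; exact h3
      simp [h4]
  have hcount : Countable (Σ μ, w μ) := hv.countable_of_separableSpace
  have hinf : Infinite (Σ μ, w μ) := by
    by_contra hfin
    rw [not_infinite_iff_finite] at hfin
    have := Fintype.ofFinite (Σ μ, w μ)
    exact hH ((HilbertBasis.mkOfOrthogonalEqBot hv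
      hbot).toOrthonormalBasis.toBasis.finiteDimensional_of_finite)
  obtain ⟨f⟩ := nonempty_equiv_of_countable (α := ℕ) (β := Σ μ, w μ)
  have hvf : Orthonormal ℝ (v ∘ f) := hv.comp f f.injective
  have hbotf : (Submodule.span ℝ (Set.range (v ∘ f)))ᗮ = ⊥ := by
    rwa [f.surjective.range_comp]
  refine ⟨HilbertBasis.mkOfOrthogonalEqBot hvf hbotf, fun i => (f i).1, fun i => ?_⟩
  rw [HilbertBasis.coe_mkOfOrthogonalEqBot]
  exact Module.End.mem_eigenspace_iff.1 (c (f i).1 (f i).2).2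

/-- The (uncentered) covariance operator of a square-integrable random element of a Hilbert space. -/
noncomputable def secondMomentOperator {Ω : Type*} [MeasurableSpace Ω] (P : Measure Ω) (Y : Ω → H) :
    H →L[ℝ] H :=
  ∫ ω, InnerProductSpace.rankOne ℝ (Y ω) (Y ω) ∂P

variable {Ω : Type*} [MeasurableSpace Ω] {P : Measure Ω} {Y : Ω → H}

theorem MeasureTheory.MemLp.integrable_rankOne_self (hY : MemLp Y 2 P) :
    Integrable (fun ω => InnerProductSpace.rankOne ℝ (Y ω) (Y ω)) P := by
  have hc : Continuous fun y : H => InnerProductSpace.rankOne ℝ y y :=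
    (InnerProductSpace.rankOne ℝ).continuous.clm_apply continuous_id
  refine (hY.integrable_norm_pow two_ne_zero).mono
    (hc.comp_aestronglyMeasurable hY.1) (Eventually.of_forall fun ω => ?_)
  simp [pow_two]

theorem secondMomentOperator_apply (hY : MemLp Y 2 P) (u : H) :
    secondMomentOperator P Y u = ∫ ω, ⟪Y ω, u⟫_ℝ • Y ω ∂P := by
  rw [secondMomentOperator, ContinuousLinearMap.integral_apply hY.integrable_rankOne_self]
  simp

variable [CompleteSpace H]

theorem inner_secondMomentOperator [IsProbabilityMeasure P] (hY : MemLp Y 2 P) (u v : H) :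
    ⟪secondMomentOperator P Y u, v⟫_ℝ = ∫ ω, ⟪Y ω, u⟫_ℝ * ⟪Y ω, v⟫_ℝ ∂P := by
  have hint : Integrable (fun ω => ⟪Y ω, u⟫_ℝ • Y ω) P := by
    simpa using hY.integrable_rankOne_self.apply_continuousLinearMap u
  rw [secondMomentOperator_apply hY, real_inner_comm, ← integral_inner hint]
  simp [inner_smul_right, real_inner_comm]

theorem secondMomentOperator_isSymmetric [IsProbabilityMeasure P] (hY : MemLp Y 2 P) :
    (secondMomentOperator P Y).IsSymmetric := by
  intro u v
  have h1 := inner_secondMomentOperator hY u v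
  have h2 := inner_secondMomentOperator hY v u
  rw [real_inner_comm] at h2
  exact h1.trans ((integral_congr_ae (Eventually.of_forall fun ω => mul_comm _ _)).trans h2.symm)

/-- Compact operators form a closed convex set, and the mean of a random element of such a set under
a probability measure stays in it. -/
theorem isCompactOperator_secondMomentOperator [IsProbabilityMeasure P] (hY : MemLp Y 2 P) :
    IsCompactOperator (secondMomentOperator P Y) := by
  have hconv : Convex ℝ {f : H →L[ℝ] H | IsCompactOperator f} := by
    intro f hf g hg a b _ _ _
    exact (hf.smul a).add (hg.smul b)
  refine hconv.integral_mem isClosed_setOfPred_isCompactOperator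
    (Eventually.of_forall fun ω => ?_) hY.integrable_rankOne_self
  have h : IsCompactOperator (innerSL ℝ (Y ω)) :=
    isCompactOperator_of_locallyCompactSpace_dom _
  exact h.clm_comp (ContinuousLinearMap.toSpanSingleton ℝ (Y ω))

end Hilbert

/-! ### Square-integrable functions of two variables as L²-valued functions. -/

section Curry

variable {α β : Type*} [MeasurableSpace α] [MeasurableSpace β] {μ : Measure α} {ν : Measure β}

theorem MeasureTheory.L2.inner_eq_integral_mul {f g : Lp ℝ 2 μ} {u w : α → ℝ} (hu : f =ᵐ[μ] u)
    (hw : g =ᵐ[μ] w) : ⟪f, g⟫_ℝ = ∫ x, u x * w x ∂μ := by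
  rw [L2.inner_def]
  refine integral_congr_ae ?_
  filter_upwards [hu, hw] with x h1 h2
  rw [h1, h2]; simp [mul_comm]

/-- The **Cauchy-Schwarz inequality** for square-integrable functions. -/
theorem MeasureTheory.MemLp.sq_integral_mul_le {f g : α → ℝ} (hf : MemLp f 2 μ)
    (hg : MemLp g 2 μ) : (∫ x, f x * g x ∂μ) ^ 2 ≤ (∫ x, f x ^ 2 ∂μ) * ∫ x, g x ^ 2 ∂μ := by
  have := real_inner_mul_inner_self_le hf.toLp hg.toLp
  simp only [L2.inner_eq_integral_mul hf.coeFn_toLp hg.coeFn_toLp,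
    L2.inner_eq_integral_mul hf.coeFn_toLp hf.coeFn_toLp,
    L2.inner_eq_integral_mul hg.coeFn_toLp hg.coeFn_toLp] at this
  simpa [pow_two] using this

theorem MeasureTheory.MemLp.fst_mul_snd {f : α → ℝ} {g : β → ℝ} (hf : MemLp f 2 μ)
    (hg : MemLp g 2 ν) : MemLp (fun p : α × β => f p.1 * g p.2) 2 (μ.prod ν) := by
  refine (memLp_two_iff_integrable_sq (hf.1.comp_fst.mul hg.1.comp_snd)).2 ?_
  simpa [mul_pow] using hf.integrable_sq.mul_prod hg.integrable_sq

variable [SFinite μ] [SFinite ν]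

theorem MeasureTheory.MemLp.ae_memLp_two_right {F : α × β → ℝ} (hF : MemLp F 2 (μ.prod ν)) :
    ∀ᵐ x ∂μ, MemLp (fun y => F (x, y)) 2 ν := by
  filter_upwards [hF.integrable_sq.prod_right_ae, hF.1.prodMk_left] with x h1 h2
  exact (memLp_two_iff_integrable_sq h2).2 h1

/-- A square-integrable function of two variables is a square-integrable function with values in
the square-integrable functions of the second variable. -/
theorem MeasureTheory.MemLp.exists_curry [TopologicalSpace.SeparableSpace (Lp ℝ 2 ν)]
    {F : α × β → ℝ} (hF : MemLp F 2 (μ.prod ν)) :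
    ∃ Y : α → Lp ℝ 2 ν, MemLp Y 2 μ ∧ ∀ᵐ x ∂μ, Y x =ᵐ[ν] fun y => F (x, y) := by
  classical
  let Y : α → Lp ℝ 2 ν := fun x => if h : MemLp (fun y => F (x, y)) 2 ν then h.toLp else 0
  have hY : ∀ᵐ x ∂μ, Y x =ᵐ[ν] fun y => F (x, y) := by
    filter_upwards [hF.ae_memLp_two_right] with x hx
    simpa [Y, hx] using hx.coeFn_toLp
  obtain ⟨w, b, -⟩ := exists_hilbertBasis ℝ (Lp ℝ 2 ν)
  have : Countable w := b.orthonormal.countable_of_separableSpace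
  have hcoord : ∀ u : Lp ℝ 2 ν, AEStronglyMeasurable (fun x => ⟪u, Y x⟫_ℝ) μ := by
    intro u
    have h1 : AEStronglyMeasurable (fun p : α × β => u p.2 * F p) (μ.prod ν) :=
      (Lp.aestronglyMeasurable u).comp_snd.mul hF.1
    refine h1.integral_prod_right'.congr ?_
    filter_upwards [hY] with x hx
    exact (L2.inner_eq_integral_mul (ae_eq_refl _) hx).symm
  -- `Y` is the limit of its finite basis expansions, whose coefficients are measurable by Fubini;
  -- the basis is countable, so a limit along finite subsets preserves measurability.
  have hmeas : AEStronglyMeasurable Y μ := by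
    refine aestronglyMeasurable_of_tendsto_ae (atTop : Filter (Finset w))
      (f := fun s x => ∑ i ∈ s, ⟪b i, Y x⟫_ℝ • b i) (fun s => ?_)
      (Eventually.of_forall fun x => ?_)
    · exact Finset.aestronglyMeasurable_fun_sum _ fun i _ => (hcoord (b i)).smul_const _
    · simpa [HasSum, b.repr_apply_apply] using b.hasSum_repr (Y x)
  refine ⟨Y, (memLp_two_iff_integrable_sq_norm hmeas).2 ?_, hY⟩
  refine hF.integrable_sq.integral_prod_left.congr ?_
  filter_upwards [hY] with x hx
  rw [← real_inner_self_eq_norm_sq, L2.inner_eq_integral_mul hx hx]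
  simp [pow_two]

/-- The weighted mean of the curried function is the pointwise weighted mean. -/
theorem MeasureTheory.MemLp.integral_smul_curry {F : α × β → ℝ} (hF : MemLp F 2 (μ.prod ν))
    {Y : α → Lp ℝ 2 ν} (hY : MemLp Y 2 μ) (hYF : ∀ᵐ x ∂μ, Y x =ᵐ[ν] fun y => F (x, y))
    {Z : α → ℝ} (hZ : MemLp Z 2 μ) :
    (∫ x, Z x • Y x ∂μ : Lp ℝ 2 ν) =ᵐ[ν] fun y => ∫ x, F (x, y) * Z x ∂μ := by
  have hFs : MemLp (fun p : β × α => F p.swap) 2 (ν.prod μ) :=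
    hF.comp_measurePreserving Measure.measurePreserving_swap
  have hg : MemLp (fun y => ∫ x, F (x, y) * Z x ∂μ) 2 ν := by
    have hm : AEStronglyMeasurable (fun y => ∫ x, F (x, y) * Z x ∂μ) ν :=
      AEStronglyMeasurable.integral_prod_right' (f := fun p : β × α => F p.swap * Z p.2)
        (hFs.1.mul hZ.1.comp_snd)
    refine (memLp_two_iff_integrable_sq hm).2 ?_
    refine (hFs.integrable_sq.integral_prod_left.mul_const (∫ x, Z x ^ 2 ∂μ)).mono'
      (hm.pow 2) ?_
    filter_upwards [hFs.ae_memLp_two_right] with y hy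
    rw [Real.norm_of_nonneg (sq_nonneg _)]
    exact hy.sq_integral_mul_le hZ
  have hint : Integrable (fun x => Z x • Y x) μ := memLp_one_iff_integrable.1 (hY.smul hZ)
  -- Both sides are tested against every `u`; Fubini identifies the pairings.
  have heq : (∫ x, Z x • Y x ∂μ : Lp ℝ 2 ν) = hg.toLp := by
    refine ext_inner_left ℝ fun u => ?_
    rw [← integral_inner hint, L2.inner_eq_integral_mul (ae_eq_refl u) hg.coeFn_toLp]
    have hu : MemLp u 2 ν := Lp.memLp u
    have hprod : Integrable (fun p : α × β => (Z p.1 * u p.2) * F p) (μ.prod ν) :=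
      (hZ.fst_mul_snd hu).integrable_mul hF
    calc ∫ x, ⟪u, Z x • Y x⟫_ℝ ∂μ = ∫ x, ∫ y, (Z x * u y) * F (x, y) ∂ν ∂μ := by
          refine integral_congr_ae ?_
          filter_upwards [hYF] with x hx
          rw [inner_smul_right, L2.inner_eq_integral_mul (ae_eq_refl u) hx,
            ← integral_const_mul]
          simp only [mul_assoc]
      _ = ∫ y, ∫ x, (Z x * u y) * F (x, y) ∂μ ∂ν := integral_integral_swap hprod
      _ = ∫ y, u y * ∫ x, F (x, y) * Z x ∂μ ∂ν := by
          congr 1 with y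
          rw [← integral_const_mul]
          congr 1 with x
          ring
  rw [heq]
  exact hg.coeFn_toLp

end Curry

/-! ### Infinite dimension of L². -/

section Infinite

variable {T : Type*} [TopologicalSpace T] [T2Space T] [MeasurableSpace T] [BorelSpace T]
  {μ : Measure T} [μ.IsOpenPosMeasure] [IsLocallyFiniteMeasure μ] [NullSingletonClass μ]

/-- `L²` of a measure without atoms that charges every open set is infinite-dimensional. -/
theorem MeasureTheory.Lp.not_finiteDimensional_two [Nonempty T] :
    ¬ FiniteDimensional ℝ (Lp ℝ 2 μ) := by
  have hinf : Infinite T := by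
    by_contra h
    rw [not_infinite_iff_finite] at h
    have h0 : μ Set.univ = 0 := Set.finite_univ.measure_zero μ
    exact (isOpen_univ.measure_ne_zero μ Set.univ_nonempty) h0
  obtain ⟨U, hUinf, hUo, hd⟩ := exists_seq_infinite_isOpen_pairwise_disjoint T
  -- Shrinking to finite measure puts the indicators in L²; disjointness makes them orthogonal.
  have hV : ∀ n, ∃ V ⊆ U n, IsOpen V ∧ V.Nonempty ∧ μ V < ⊤ := by
    intro n
    obtain ⟨t, ht⟩ := (hUinf n).nonempty
    obtain ⟨W, hW, hWo, hWμ⟩ := μ.exists_isOpen_measure_lt_top t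
    exact ⟨U n ∩ W, Set.inter_subset_left, (hUo n).inter hWo, ⟨t, ht, hW⟩,
      (measure_mono Set.inter_subset_right).trans_lt hWμ⟩
  choose V hVU hVo hVne hVμ using hV
  let v : ℕ → Lp ℝ 2 μ := fun n =>
    indicatorConstLp 2 (hVo n).measurableSet (hVμ n).ne (1 : ℝ)
  have hv : LinearIndependent ℝ v := by
    refine linearIndependent_of_ne_zero_of_inner_eq_zero (𝕜 := ℝ) (fun n => ?_) fun n m hnm => ?_
    · rw [Ne, ← norm_eq_zero, norm_indicatorConstLp two_ne_zero (by simp)]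
      have : 0 < μ.real (V n) :=
        ENNReal.toReal_pos ((hVo n).measure_ne_zero μ (hVne n)) (hVμ n).ne
      simp only [norm_one, one_mul]
      positivity
    · have hdis : V n ∩ V m = ∅ :=
        Set.disjoint_iff_inter_eq_empty.1 ((hd hnm).mono (hVU n) (hVU m))
      change ⟪v n, v m⟫_ℝ = 0
      rw [L2.real_inner_indicatorConstLp_one_indicatorConstLp_one (hVo n).measurableSet
        (hVo m).measurableSet (hVμ n).ne (hVμ m).ne, hdis]
      simp
  intro hfd
  exact not_finite_iff_infinite.2 inferInstance hv.finite

end Infinite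

/-! ### Lebesgue measure on `D`. -/

section Subtype

variable {D : Set ℝ}

theorem MeasureTheory.map_subtype_val_volume (hD : MeasurableSet D) :
    (volume : Measure D).map Subtype.val = volume.restrict D :=
  map_comap_subtype_coe hD volume

theorem MeasureTheory.sigmaFinite_volume_subtype (hD : MeasurableSet D) :
    SigmaFinite (volume : Measure D) := by
  refine SigmaFinite.of_map _ measurable_subtype_coe.aemeasurable ?_
  rw [map_subtype_val_volume hD]
  infer_instance

theorem MeasureTheory.nullSingletonClass_volume_subtype (hD : MeasurableSet D) :
    NullSingletonClass (volume : Measure D) := by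
  refine ⟨fun t => ?_⟩
  rw [Measure.Subtype.volume_def, comap_subtype_coe_apply hD]
  simp

theorem MeasureTheory.isLocallyFiniteMeasure_volume_subtype (hD : MeasurableSet D) :
    IsLocallyFiniteMeasure (volume : Measure D) := by
  refine ⟨fun t => ?_⟩
  obtain ⟨U, hU, hUμ⟩ := (volume : Measure ℝ).finiteAt_nhds (t : ℝ)
  refine ⟨Subtype.val ⁻¹' U, continuous_subtype_val.continuousAt.preimage_mem_nhds hU, ?_⟩
  rw [Measure.Subtype.volume_def, comap_subtype_coe_apply hD]
  exact (measure_mono (Set.image_preimage_subset _ _)).trans_lt hUμ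

theorem MeasureTheory.isOpenPosMeasure_volume_subtype (hD : MeasurableSet D)
    (h : ∀ t ∈ D, ∀ r : ℝ, 0 < r → 0 < volume (D ∩ Metric.ball t r)) :
    (volume : Measure D).IsOpenPosMeasure := by
  refine ⟨fun U hU ⟨t, ht⟩ => ?_⟩
  obtain ⟨r, hr, hrU⟩ := Metric.isOpen_iff.1 hU t ht
  refine ((h t t.2 r hr).trans_le ?_).ne'
  rw [Measure.Subtype.volume_def, comap_subtype_coe_apply hD]
  refine measure_mono ?_
  rintro x ⟨hxD, hx⟩
  exact ⟨⟨x, hxD⟩, hrU hx, rfl⟩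

end Subtype

/-! ### Consequences of mean-square continuity. -/

section MeanSquare

variable {Ω : Type*} [MeasurableSpace Ω] {P : Measure Ω} {D : Set ℝ} {X : D → Ω → ℝ}

/-- The good indices have full measure, hence are dense. Some good `s` near `t` has E[(X_s - X_t)²]
< 1, and X_t = X_s - (X_s - X_t). -/
theorem IsMeanSquareContinuous.memLp_two [(volume : Measure D).IsOpenPosMeasure]
    (hX : IsStochasticProcess X) (hcont : IsMeanSquareContinuous X P)
    (hae : ∀ᵐ t : D, MemLp (X t) 2 P) (t : D) : MemLp (X t) 2 P := by
  have hnhds : ∀ᶠ s : D in 𝓝 t, ∫⁻ ω, ENNReal.ofReal ((X s ω - X t ω) ^ 2) ∂P < 1 :=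
    (hcont t).eventually_lt_const zero_lt_one
  obtain ⟨s, hs, hst⟩ := (mem_closure_iff_nhds.1
    ((Measure.dense_of_ae hae) t) _ hnhds)
  have hm : Measurable fun ω => X s ω - X t ω := (hX s).sub (hX t)
  have hdiff : MemLp (fun ω => X s ω - X t ω) 2 P := by
    refine (memLp_two_iff_integrable_sq hm.aestronglyMeasurable).2
      ⟨(hm.pow_const 2).aestronglyMeasurable, ?_⟩
    rw [hasFiniteIntegral_iff_ofReal (Eventually.of_forall fun ω => sq_nonneg _)]
    exact hs.trans ENNReal.one_lt_top
  have := hst.sub hdiff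
  refine this.ae_eq (Eventually.of_forall fun ω => ?_)
  simp

theorem IsMeanSquareContinuous.continuous_toLp (hcont : IsMeanSquareContinuous X P)
    (hL : ∀ t, MemLp (X t) 2 P) : Continuous fun t => (hL t).toLp := by
  refine continuous_iff_continuousAt.2 fun t => ?_
  rw [ContinuousAt, Lp.tendsto_Lp_iff_tendsto_eLpNorm'']
  have h : ∀ s, eLpNorm (X s - X t) 2 P
      = (∫⁻ ω, ENNReal.ofReal ((X s ω - X t ω) ^ 2) ∂P) ^ (1 / 2 : ℝ) := by
    intro s
    rw [eLpNorm_eq_lintegral_rpow_enorm_toReal two_ne_zero (by simp)]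
    simp only [ENNReal.toReal_ofNat, Pi.sub_apply]
    congr 2 with ω
    rw [← sq_abs, ENNReal.ofReal_pow (abs_nonneg _), ← Real.norm_eq_abs, ofReal_norm]
    norm_cast
  simp only [h]
  have := ((ENNReal.continuous_rpow_const (y := 1 / 2)).tendsto 0).comp (hcont t)
  simpa [Function.comp_def] using this

end MeanSquare

/-! ### The Karhunen–Loève expansion. -/

theorem mainTheorem2 {Ω : Type*} [MeasurableSpace Ω] (P : Measure Ω) [IsProbabilityMeasure P]
    (D : Set ℝ) (hD : MeasurableSet D) (hDne : D.Nonempty)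
    (hDpos : ∀ t ∈ D, ∀ r : ℝ, 0 < r → 0 < volume (D ∩ Metric.ball t r))
    (X : D → Ω → ℝ) (hX : IsStochasticProcess X) (hcent : IsCentered X P)
    (hcont : IsMeanSquareContinuous X P)
    (hL2 : MemLp (fun p : D × Ω => X p.1 p.2) 2 ((volume : Measure D).prod P)) :
    ∃ (b : HilbertBasis ℕ ℝ (Lp ℝ 2 (volume : Measure D))) (e : ℕ → D → ℝ) (lam : ℕ → ℝ)
      (ξ : ℕ → Ω → ℝ),
      -- `e i` is an everywhere defined representative of the `i`-th basis vector,
      (∀ i, b i =ᵐ[volume] e i) ∧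
      -- and an eigenfunction of the autocorrelation operator, with eigenvalue `lam i ≥ 0`
      (∀ i, 0 ≤ lam i) ∧
      (∀ i, ∀ s : D, autocorrelationOperator X P (e i) s = lam i * e i s) ∧
      -- the integrals defining the coefficients exist almost surely
      (∀ i, ∀ᵐ ω ∂P, Integrable (fun t : D => X t ω * e i t)) ∧
      -- coefficients with zero eigenvalue vanish almost surely
      (∀ i, lam i = 0 → ∀ᵐ ω ∂P, ∫ t : D, X t ω * e i t = 0) ∧
      -- the normalized coefficients (with Lean's `0⁻¹ = 0`, `ξ i = 0` when `lam i = 0`)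
      (∀ i ω, ξ i ω = (√(lam i))⁻¹ * ∫ t : D, X t ω * e i t) ∧
      -- are centered, of unit variance and mutually uncorrelated
      (∀ i, 0 < lam i →
        MemLp (ξ i) 2 P ∧ ∫ ω, ξ i ω ∂P = 0 ∧ variance (ξ i) P = 1) ∧
      (∀ i j, 0 < lam i → 0 < lam j → i ≠ j → covariance (ξ i) (ξ j) P = 0) ∧
      -- the expansion converges in mean square for every `t ∈ D`
      (∀ t : D, MemLp (X t) 2 P ∧
        Tendsto (fun N : ℕ =>
          eLpNorm (fun ω => X t ω - ∑ i ∈ Finset.range N, √(lam i) * ξ i ω * e i t) 2 P)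
          atTop (𝓝 0)) := by
  have := sigmaFinite_volume_subtype hD
  have := nullSingletonClass_volume_subtype hD
  have := isLocallyFiniteMeasure_volume_subtype hD
  have := isOpenPosMeasure_volume_subtype hD hDpos
  have : Nonempty D := hDne.to_subtype
  have : Fact ((2 : ENNReal) ≠ ⊤) := ⟨by simp⟩
  -- the sections of the process in the two directions
  have hL : ∀ t, MemLp (X t) 2 P := hcont.memLp_two hX hL2.ae_memLp_two_right
  have hF : MemLp (fun p : Ω × D => X p.2 p.1) 2 (P.prod volume) :=
    hL2.comp_measurePreserving Measure.measurePreserving_swap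
  obtain ⟨Y, hY, hYX⟩ := hF.exists_curry
  let x : D → Lp ℝ 2 P := fun t => (hL t).toLp
  have hx : ∀ t, x t =ᵐ[P] X t := fun t => (hL t).coeFn_toLp
  have hxc : Continuous x := hcont.continuous_toLp hL
  -- the coefficients of the sections in `L²(D)`
  have hcoef : ∀ u, MemLp (fun ω => inner ℝ (Y ω) u) 2 P := fun u => hY.inner_const u
  let C : Lp ℝ 2 (volume : Measure D) → Lp ℝ 2 P := fun u => (hcoef u).toLp
  have hC : ∀ u, C u =ᵐ[P] fun ω => inner ℝ (Y ω) u := fun u => (hcoef u).coeFn_toLp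
  have hmean : ∀ Z : Lp ℝ 2 P,
      (∫ ω, Z ω • Y ω ∂P : Lp ℝ 2 (volume : Measure D)) =ᵐ[volume] fun t => ⟪x t, Z⟫_ℝ := by
    intro Z
    filter_upwards [hF.integral_smul_curry hY hYX (Lp.memLp Z)] with t ht
    rw [ht, L2.inner_eq_integral_mul (hx t) (ae_eq_refl Z)]
  -- The adjoint relation between Z ↦ E[Z Y] and `C`.
  have hmean_inner : ∀ (Z : Lp ℝ 2 P) u, ⟪∫ ω, Z ω • Y ω ∂P, u⟫_ℝ = ⟪Z, C u⟫_ℝ := by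
    intro Z u
    have hint : Integrable (fun ω => Z ω • Y ω) P :=
      memLp_one_iff_integrable.1 (hY.smul (Lp.memLp Z))
    rw [real_inner_comm, ← integral_inner hint, L2.inner_eq_integral_mul (ae_eq_refl Z) (hC u)]
    simp [inner_smul_right, real_inner_comm]
  -- the covariance operator and its eigenbasis
  obtain ⟨b, lam, hb⟩ := exists_hilbertBasis_nat_eigenvectors Lp.not_finiteDimensional_two
    (isCompactOperator_secondMomentOperator hY) (secondMomentOperator_isSymmetric hY)
  have hCC : ∀ i j, ⟪C (b i), C (b j)⟫_ℝ = if i = j then lam i else 0 := by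
    intro i j
    rw [L2.inner_eq_integral_mul (hC _) (hC _), ← inner_secondMomentOperator hY, hb,
      real_inner_smul_left, orthonormal_iff_ite.1 b.orthonormal i j]
    simp
  have hlam : ∀ i, 0 ≤ lam i := fun i => by
    have := hCC i i
    rw [if_pos rfl] at this
    exact this ▸ real_inner_self_nonneg
  have hC0 : ∀ i, lam i = 0 → C (b i) = 0 := fun i hi => by
    have := hCC i i
    rwa [if_pos rfl, hi, inner_self_eq_zero] at this
  have hKb : ∀ i, (fun t => lam i * b i t) =ᵐ[volume] fun t => ⟪x t, C (b i)⟫_ℝ := by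
    intro i
    have h1 : (∫ ω, C (b i) ω • Y ω ∂P) = lam i • b i := by
      rw [← hb, secondMomentOperator_apply hY]
      refine integral_congr_ae ?_
      filter_upwards [hC (b i)] with ω hω
      rw [hω]
    filter_upwards [hmean (C (b i)), Lp.coeFn_smul (lam i) (b i)] with t h2 h3
    rw [← h2, h1, h3, Pi.smul_apply, smul_eq_mul]
  -- everywhere defined eigenfunctions
  let e : ℕ → D → ℝ := fun i t => if lam i = 0 then b i t else (lam i)⁻¹ * ⟪x t, C (b i)⟫_ℝ
  have he : ∀ i, b i =ᵐ[volume] e i := by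
    intro i
    by_cases hi : lam i = 0
    · simp [e, hi]
    · filter_upwards [hKb i] with t ht
      simp only [e, hi, if_false]
      rw [← ht, inv_mul_cancel_left₀ hi]
  have hxe : ∀ i t, ⟪x t, C (b i)⟫_ℝ = lam i * e i t := by
    intro i t
    by_cases hi : lam i = 0
    · simp [hi, hC0 i hi]
    · simp [e, hi]
  have hYe : ∀ i, ∀ᵐ ω ∂P, ⟪Y ω, b i⟫_ℝ = ∫ t, X t ω * e i t := by
    intro i
    filter_upwards [hYX] with ω hω
    exact L2.inner_eq_integral_mul hω (he i)
  have hCe : ∀ i, C (b i) =ᵐ[P] fun ω => ∫ t, X t ω * e i t := fun i => (hC (b i)).trans (hYe i)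
  let ξ : ℕ → Ω → ℝ := fun i ω => (√(lam i))⁻¹ * ∫ t : D, X t ω * e i t
  let η : ℕ → Lp ℝ 2 P := fun i => (√(lam i))⁻¹ • C (b i)
  have hξ : ∀ i, η i =ᵐ[P] ξ i := by
    intro i
    filter_upwards [Lp.coeFn_smul (√(lam i))⁻¹ (C (b i)), hCe i] with ω h1 h2
    rw [h1, Pi.smul_apply, h2, smul_eq_mul]
  have hξL : ∀ i, MemLp (ξ i) 2 P := fun i => (memLp_congr_ae (hξ i)).1 (Lp.memLp _)
  have hηη : ∀ i j, 0 < lam i → 0 < lam j → ⟪η i, η j⟫_ℝ = if i = j then 1 else 0 := by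
    intro i j hi hj
    rw [real_inner_smul_left, real_inner_smul_right, hCC]
    split_ifs with h
    · subst h
      rw [← mul_assoc, ← mul_inv, Real.mul_self_sqrt hi.le, inv_mul_cancel₀ hi.ne']
    · simp
  have hone : MemLp (fun _ : Ω => (1 : ℝ)) 2 P := memLp_const 1
  let I : Lp ℝ 2 P := hone.toLp
  have hI : I =ᵐ[P] fun _ => (1 : ℝ) := hone.coeFn_toLp
  -- Centering is the adjoint applied to the constant 1, so that all coefficients have mean zero at
  -- once.
  have hYmean : ∫ ω, I ω • Y ω ∂P = 0 := by
    refine Lp.ext ?_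
    filter_upwards [hmean I, Lp.coeFn_zero ℝ 2 (volume : Measure D)] with t h1 h2
    rw [h1, h2, L2.inner_eq_integral_mul (hx t) hI]
    simpa using hcent t
  have hξmean : ∀ i, ∫ ω, ξ i ω ∂P = 0 := by
    intro i
    have h1 := hmean_inner I (b i)
    rw [hYmean, inner_zero_left, L2.inner_eq_integral_mul hI (hCe i)] at h1
    simp only [one_mul] at h1
    simp only [ξ, integral_const_mul, ← h1, mul_zero]
  have hηx : ∀ i t, ⟪η i, x t⟫_ℝ = √(lam i) * e i t := by
    intro i t
    rw [real_inner_smul_left, real_inner_comm, hxe, ← mul_assoc, inv_mul_eq_div, Real.div_sqrt]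
  refine ⟨b, e, lam, ξ, he, hlam, fun i s => ?_, fun i => ?_, fun i hi => ?_, fun i ω => rfl,
    fun i hi => ⟨hξL i, hξmean i, ?_⟩, fun i j hi hj hij => ?_, fun t => ⟨hL t, ?_⟩⟩
  -- E[X_s Y] is represented by R_X(s, ·), so pairing it with `b i` gives (K e_i)(s) at every `s`,
  -- not just almost everywhere.
  · rw [← hxe, ← hmean_inner]
    refine (L2.inner_eq_integral_mul ?_ (he i)).symm
    filter_upwards [hmean (x s)] with t ht
    rw [ht, real_inner_comm, L2.inner_eq_integral_mul (hx s) (hx t), autocorrelation]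
  · filter_upwards [hYX] with ω hω
    exact ((memLp_congr_ae hω).1 (Lp.memLp _)).integrable_mul
      ((memLp_congr_ae (he i)).1 (Lp.memLp _))
  · filter_upwards [hCe i, Lp.coeFn_zero ℝ 2 P] with ω h1 h2
    rw [← h1, hC0 i hi, h2]; rfl
  · rw [variance_of_integral_eq_zero (hξL i).1.aemeasurable (hξmean i)]
    have h1 := L2.inner_eq_integral_mul (hξ i) (hξ i)
    rw [hηη i i hi hi, if_pos rfl] at h1
    simpa [pow_two] using h1.symm
  · rw [covariance, hξmean, hξmean]
    have h1 := L2.inner_eq_integral_mul (hξ i) (hξ j)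
    rw [hηη i j hi hj, if_neg hij] at h1
    simpa using h1.symm
  -- Indices with zero eigenvalue have `η i = 0`; they are dropped for orthonormality and restored
  -- in `hsum`.
  · let v : {i // 0 < lam i} → Lp ℝ 2 P := fun i => η i
    have hv : Orthonormal ℝ v := by
      refine orthonormal_iff_ite.2 fun i j => ?_
      simp only [v, hηη i j i.2 j.2, Subtype.ext_iff]
    have htot : ∀ Z, (∀ i, ⟪v i, Z⟫_ℝ = 0) → ⟪x t, Z⟫_ℝ = 0 := by
      intro Z hZ
      have hCZ : ∀ i, ⟪Z, C (b i)⟫_ℝ = 0 := by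
        intro i
        rcases (hlam i).eq_or_lt with hi | hi
        · simp [hC0 i hi.symm]
        · have h1 := hZ ⟨i, hi⟩
          rw [real_inner_smul_left, mul_eq_zero] at h1
          rw [real_inner_comm]
          exact h1.resolve_left (inv_ne_zero (Real.sqrt_ne_zero'.2 hi))
      have h0 : ∫ ω, Z ω • Y ω ∂P = 0 := by
        refine b.repr.map_eq_zero_iff.1 ?_
        ext i
        rw [b.repr_apply_apply, real_inner_comm, hmean_inner, hCZ]
        rfl
      have h1 : (fun s => ⟪x s, Z⟫_ℝ) =ᵐ[volume] fun _ => (0 : ℝ) := by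
        filter_upwards [hmean Z, Lp.coeFn_zero ℝ 2 (volume : Measure D)] with s h2 h3
        rw [← h2, h0, h3]; rfl
      -- Continuous functions that agree almost everywhere agree everywhere, since the measure
      -- charges open sets.
      have h2 := (Continuous.ae_eq_iff_eq volume (hxc.inner continuous_const)
        continuous_const).1 h1
      exact congrFun h2 t
    have hsub := hv.hasSum_inner_smul htot
    have hsum : HasSum (fun i => ⟪η i, x t⟫_ℝ • η i) (x t) := by
      refine (hasSum_subtype_iff_of_support_subset (s := {i | 0 < lam i}) ?_).1 hsub
      intro i hi
      by_contra hneg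
      have h0 : lam i = 0 := le_antisymm (not_lt.1 hneg) (hlam i)
      exact hi (by simp [η, h0])
    have hlim := hsum.tendsto_sum_nat
    rw [tendsto_iff_edist_tendsto_0] at hlim
    refine hlim.congr fun N => ?_
    rw [edist_comm, Lp.edist_def]
    refine eLpNorm_congr_ae ?_
    have hall : ∀ᵐ ω ∂P, ∀ i, η i ω = ξ i ω := ae_all_iff.2 hξ
    have hsm : ∀ᵐ ω ∂P, ∀ i, (⟪η i, x t⟫_ℝ • η i : Lp ℝ 2 P) ω = ⟪η i, x t⟫_ℝ * η i ω :=
      ae_all_iff.2 fun i => Lp.coeFn_smul _ _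
    filter_upwards [hx t, hall, hsm,
      Lp.coeFn_fun_finsetSum (Finset.range N) (fun i => ⟪η i, x t⟫_ℝ • η i)] with ω h1 h2 h3 h4
    rw [Pi.sub_apply, h1, h4]
    congr 1
    refine Finset.sum_congr rfl fun i _ => ?_
    rw [h3, h2, hηx]
    ring
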